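/- Let $I=[0,1]$, let $\mathrm{Homeo}^+(I)$ be the group of orientation-preserving homeomorphisms of $I$, and for $f\in\mathrm{Homeo}^+(I)$ write $\operatorname{supp} f=\{x\in I : f(x)\neq x\}$. Let $$F=\langle A,B \mid [A,(AB)^{-1}B(AB)],\ [A,(AB)^{-2}B(AB)^{2}]\rangle$$ be Thompson's group. A subgroup $G<\mathrm{Homeo}^+(I)$ is called a \emph{square root of $F$} if $G=\langle f,g\rangle$ for some $f,g\in\mathrm{Homeo}^+(I)$ such that $\langle f^2,g^2\rangle\cong F$ and such that $\operatorname{supp} f$ and $\operatorname{supp} g$ are nonempty open intervals whose intersection is nonempty and is a proper subinterval of each of them. Let $\mathcal{S}$ be the set of isomorphism classes (as abstract groups) of square roots of $F$. Then $\mathcal{S}$ is uncountable; that is, there are uncountably many pairwise non-isomorphic groups among the square roots of $F$. -/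

import Mathlib

/-- The unit interval `I = [0,1]`. -/
abbrev UnitI : Type := Set.Icc (0 : ℝ) 1

/-- `Homeo⁺(I)`: the orientation-preserving (that is, increasing) homeomorphisms of `I = [0,1]`,
a subgroup of the group of all homeomorphisms of `I` under composition. -/
def HomeoPlus : Subgroup (UnitI ≃ₜ UnitI) where
  carrier := {f | StrictMono f}
  one_mem' := fun _ _ h => h
  mul_mem' := fun {_ _} hf hg _ _ h => hf (hg h)
  inv_mem' := by
    intro f hf x y h
    by_contra hn
    have h1 := hf.monotone (not_lt.mp hn)
    have e : ∀ z, f (f⁻¹ z) = z := fun z => f.apply_symm_apply z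
    rw [e, e] at h1
    exact absurd h (not_lt.mpr h1)

/-- The (open) support `{x | f x ≠ x}` of a homeomorphism of `I`. -/
def openSupport (f : HomeoPlus) : Set UnitI := {x | (f : UnitI ≃ₜ UnitI) x ≠ x}

/-- Nonempty open intervals with end points in `[0,1]`. -/
def IsOpenInterval (J : Set UnitI) : Prop := ∃ a b : UnitI, a < b ∧ J = Set.Ioo a b

/-- Two open intervals form a two-chain if their intersection is nonempty and is a proper subset
of each of them (the intersection of two intervals is automatically an interval). -/
def IsTwoChain (J₁ J₂ : Set UnitI) : Prop :=
  IsOpenInterval J₁ ∧ IsOpenInterval J₂ ∧ (J₁ ∩ J₂).Nonempty ∧ J₁ ∩ J₂ ⊂ J₁ ∧ J₁ ∩ J₂ ⊂ J₂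

/-- The relator `[A, (AB)⁻ᵏ B (AB)ᵏ]` in the free group on `A = of 0` and `B = of 1`. -/
def thompsonRelator (k : ℕ) : FreeGroup (Fin 2) :=
  let A : FreeGroup (Fin 2) := FreeGroup.of 0
  let B : FreeGroup (Fin 2) := FreeGroup.of 1
  let C : FreeGroup (Fin 2) := ((A * B) ^ k)⁻¹ * B * (A * B) ^ k
  A * C * A⁻¹ * C⁻¹

/-- Thompson's group `F = ⟨A, B ∣ [A, (AB)⁻ᵏ B (AB)ᵏ], k = 1, 2⟩`. -/
abbrev ThompsonF : Type := PresentedGroup {thompsonRelator 1, thompsonRelator 2}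

/-- A subgroup `G` of `Homeo⁺(I)` is a square root of `F` if `G = ⟨f, g⟩` for some `f, g` whose
supports form a two-chain of intervals and for which `⟨f², g²⟩ ≅ F`. -/
def IsSquareRootOfF (G : Subgroup HomeoPlus) : Prop :=
  ∃ f g : HomeoPlus, G = Subgroup.closure {f, g} ∧
    IsTwoChain (openSupport f) (openSupport g) ∧
    Nonempty (Subgroup.closure {f ^ 2, g ^ 2} ≃* ThompsonF)

/-- Abstract group isomorphism, as an equivalence relation on the square roots of `F`. -/
def squareRootIso : Setoid {G : Subgroup HomeoPlus // IsSquareRootOfF G} where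
  r G H := Nonempty (G.1 ≃* H.1)
  iseqv := ⟨fun _ => ⟨MulEquiv.refl _⟩, fun ⟨e⟩ => ⟨e.symm⟩, fun ⟨e⟩ ⟨e'⟩ => ⟨e.trans e'⟩⟩

/-- `𝒮`: the isomorphism classes of square roots of `F`. -/
def SquareRootClasses : Type := Quotient squareRootIso

/-! Work on the line instead of `[0,1]`. The roots are `leftRoot`, supported on `(-∞, 0)`, and
`rightRoot s`, supported on `(-1, ∞)`, for `s` in `[3/2, 2]`.

Their squares generate `F`. In Thompson's group every element is `p q⁻¹` with `p`, `q` words in the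
generators `xₙ` without inverses (`exists_positiveWord_mul_inv`). For a fast pair the action
separates such words, since it detects their least index (`IsFastPair.positiveWord_eq_of_map_eq`).
Hence the map from the presented group is injective.

The marked group determines `s`. Near `-1`, `rightRoot s` contracts by `2/3`, while `contraction`
contracts by `1/(2s)`. Two conjugates of the generators commute exactly when their supports are
disjoint, which compares a power of `3/2` with a power of `2s` (`encodingRelation_roots`); all these
comparisons together recover `s` (`le_of_encodingRelation_imp`).

A countable group contains only countably many pairs of elements, so each isomorphism class accounts
for countably many `s`. Thus there are uncountably many classes. -/

/-! ### The positive monoid of Thompson's group -/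

section Words

variable {G H : Type*} [Group G] [Group H]

/-- The standard infinite generating sequence `x₀ = AB`, `xₙ₊₁ = (AB)⁻ⁿ B (AB)ⁿ`. -/
def thompsonGen (A B : G) : ℕ → G
  | 0 => A * B
  | n + 1 => ((A * B) ^ n)⁻¹ * B * (A * B) ^ n

theorem map_thompsonGen (θ : G →* H) (A B : G) (n : ℕ) :
    θ (thompsonGen A B n) = thompsonGen (θ A) (θ B) n := by
  cases n <;> simp [thompsonGen]

/-- The value of a positive word in the generators `xₙ`. -/
def positiveWord (A B : G) (l : List ℕ) : G := (l.map (thompsonGen A B)).prod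

@[simp] theorem positiveWord_nil (A B : G) : positiveWord A B [] = 1 := rfl

@[simp] theorem positiveWord_cons (A B : G) (k : ℕ) (l : List ℕ) :
    positiveWord A B (k :: l) = thompsonGen A B k * positiveWord A B l := by
  simp [positiveWord]

theorem map_positiveWord (θ : G →* H) (A B : G) (l : List ℕ) :
    θ (positiveWord A B l) = positiveWord (θ A) (θ B) l := by
  induction l with
  | nil => simp
  | cons k l ih => simp [ih, map_thompsonGen]

variable {A B : G}

theorem thompsonGen_conj_zero (n : ℕ) :
    thompsonGen A B (n + 1) * thompsonGen A B 0 = thompsonGen A B 0 * thompsonGen A B (n + 2) := by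
  simp only [thompsonGen, pow_succ (A * B) n, mul_inv_rev]
  group

theorem thompsonGen_conj_pow (n m : ℕ) :
    thompsonGen A B (n + m + 1) = ((A * B) ^ m)⁻¹ * thompsonGen A B (n + 1) * (A * B) ^ m := by
  simp only [thompsonGen, pow_add, mul_inv_rev, mul_assoc]

theorem thompsonGen_shift {i j : ℕ} (m : ℕ)
    (h : thompsonGen A B (i + 1) * thompsonGen A B (j + 1)
      = thompsonGen A B (j + 1) * thompsonGen A B (i + 2)) :
    thompsonGen A B (i + m + 1) * thompsonGen A B (j + m + 1)
      = thompsonGen A B (j + m + 1) * thompsonGen A B (i + m + 2) := by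
  rw [show i + m + 2 = (i + 1) + m + 1 by ring, thompsonGen_conj_pow i, thompsonGen_conj_pow j,
    thompsonGen_conj_pow (i + 1)]
  have := congrArg (fun z => ((A * B) ^ m)⁻¹ * z * (A * B) ^ m) h
  simpa [mul_assoc] using this

theorem thompsonGen_one_comm_of_commute {n : ℕ} (h : Commute A (thompsonGen A B (n + 1))) :
    thompsonGen A B (n + 1) * thompsonGen A B 1
      = thompsonGen A B 1 * thompsonGen A B (n + 2) := by
  have h0 := thompsonGen_conj_zero (A := A) (B := B) n
  have e0 : thompsonGen A B 0 = A * B := rfl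
  have e1 : thompsonGen A B 1 = B := by simp [thompsonGen]
  rw [e0, ← mul_assoc, ← h.eq, mul_assoc, mul_assoc] at h0
  rw [e1]
  exact mul_left_cancel h0

/-- The two defining relations of Thompson's group imply the infinite family of relations
`xₙ xₖ = xₖ xₙ₊₁` for `k < n`. -/
theorem thompsonGen_mul_comm (h₁ : Commute A (thompsonGen A B 2))
    (h₂ : Commute A (thompsonGen A B 3)) {k n : ℕ} (hkn : k < n) :
    thompsonGen A B n * thompsonGen A B k = thompsonGen A B k * thompsonGen A B (n + 1) := by
  -- This is the case `k = 1`. The case `k = 0` holds by definition of `xₙ`, and larger `k` follow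
  -- on conjugating by powers of `x₀`.
  have base : ∀ d, thompsonGen A B (d + 2) * thompsonGen A B 1
      = thompsonGen A B 1 * thompsonGen A B (d + 3) := by
    intro d
    induction d using Nat.strong_induction_on with
    | _ d ih =>
      match d, ih with
      | 0, _ => exact thompsonGen_one_comm_of_commute (n := 1) h₁
      | 1, _ => exact thompsonGen_one_comm_of_commute (n := 2) h₂
      | d + 2, ih =>
        have r₁ := ih d (by omega)
        have r₂ := ih (d + 1) (by omega)
        have s₁ := thompsonGen_shift (i := 1) (j := 0) (d + 1)
          (thompsonGen_one_comm_of_commute (n := 1) h₁)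
        have s₂ := thompsonGen_shift (i := 1) (j := 0) (d + 2)
          (thompsonGen_one_comm_of_commute (n := 1) h₁)
        rw [show 1 + (d + 1) + 1 = d + 3 by ring, show 0 + (d + 1) + 1 = d + 2 by ring,
          show 1 + (d + 1) + 2 = d + 4 by ring] at s₁
        rw [show 1 + (d + 2) + 1 = d + 4 by ring, show 0 + (d + 2) + 1 = d + 3 by ring,
          show 1 + (d + 2) + 2 = d + 5 by ring] at s₂
        change thompsonGen A B (d + 4) * thompsonGen A B 1
          = thompsonGen A B 1 * thompsonGen A B (d + 5)
        change thompsonGen A B (d + 3) * thompsonGen A B 1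
          = thompsonGen A B 1 * thompsonGen A B (d + 4) at r₂
        generalize thompsonGen A B 1 = y, thompsonGen A B (d + 2) = p,
          thompsonGen A B (d + 3) = q, thompsonGen A B (d + 4) = r,
          thompsonGen A B (d + 5) = s at *
        -- With `qp = pr`, `rq = qs`, `py = yq` and `qy = yr`: `pry = qpy = qyq = yrq = yqs = pys`.
        apply mul_left_cancel (a := p)
        rw [← mul_assoc, ← s₁, mul_assoc, r₁, ← mul_assoc, r₂, mul_assoc, s₂, ← mul_assoc,
          ← r₁, mul_assoc]
  obtain _ | k := k
  · obtain _ | n := n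
    · omega
    · exact thompsonGen_conj_zero n
  · obtain ⟨d, rfl⟩ := Nat.exists_eq_add_of_lt hkn
    have := thompsonGen_shift (i := d + 1) (j := 0) k (base d)
    rw [show k + 1 + d + 1 = d + 1 + k + 1 by ring]
    simpa using this

/-- The first occurrence of `k` is pulled to the front. The letters it passes have larger index, and
each of these indices rises by one. -/
theorem exists_positiveWord_eq_cons
    (hc : ∀ {k n : ℕ}, k < n →
      thompsonGen A B n * thompsonGen A B k = thompsonGen A B k * thompsonGen A B (n + 1))
    {k : ℕ} {l : List ℕ} (hk : k ∈ l) (hl : ∀ j ∈ l, k ≤ j) :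
    ∃ l', l'.length + 1 = l.length ∧
      positiveWord A B l = thompsonGen A B k * positiveWord A B l' := by
  induction l with
  | nil => simp at hk
  | cons j l ih =>
    by_cases hj : j = k
    · exact ⟨l, by simp, by simp [hj]⟩
    · have hk' : k ∈ l := by
        rcases List.mem_cons.mp hk with h | h
        · exact absurd h.symm hj
        · exact h
      obtain ⟨l', hl', e⟩ := ih hk' fun i hi => hl i (List.mem_cons_of_mem _ hi)
      have hkj : k < j := lt_of_le_of_ne (hl j (by simp)) (Ne.symm hj)
      refine ⟨(j + 1) :: l', by simp [hl'], ?_⟩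
      rw [positiveWord_cons, e, ← mul_assoc, hc hkj, mul_assoc, positiveWord_cons]

/-- The inverse letter travels right through the word: it cancels against an equal letter, raises a
larger one by one, or is itself raised by one when passing a smaller one. Hence the induction is
over all `i`. -/
theorem exists_inv_mul_positiveWord
    (hc : ∀ {k n : ℕ}, k < n →
      thompsonGen A B n * thompsonGen A B k = thompsonGen A B k * thompsonGen A B (n + 1))
    (i : ℕ) (l : List ℕ) :
    ∃ l₁ l₂, (thompsonGen A B i)⁻¹ * positiveWord A B l
      = positiveWord A B l₁ * (positiveWord A B l₂)⁻¹ := by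
  induction l generalizing i with
  | nil => exact ⟨[], [i], by simp⟩
  | cons j l ih =>
    rcases lt_trichotomy i j with h | h | h
    · obtain ⟨l₁, l₂, e⟩ := ih i
      refine ⟨(j + 1) :: l₁, l₂, ?_⟩
      rw [positiveWord_cons, positiveWord_cons, mul_assoc, ← e]
      have := hc h
      rw [inv_mul_eq_iff_eq_mul]
      simp only [← mul_assoc]
      rw [← this]
      simp
    · exact ⟨l, [], by simp [h]⟩
    · obtain ⟨l₁, l₂, e⟩ := ih (i + 1)
      refine ⟨j :: l₁, l₂, ?_⟩
      rw [positiveWord_cons, positiveWord_cons, mul_assoc, ← e]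
      have := hc h
      rw [inv_mul_eq_iff_eq_mul]
      simp only [← mul_assoc]
      rw [this]
      simp

/-- Every element of `⟨A, B⟩` is a quotient of two positive words. -/
theorem exists_positiveWord_mul_inv
    (hc : ∀ {k n : ℕ}, k < n →
      thompsonGen A B n * thompsonGen A B k = thompsonGen A B k * thompsonGen A B (n + 1))
    {z : G} (hz : z ∈ Subgroup.closure {A, B}) :
    ∃ l₁ l₂, z = positiveWord A B l₁ * (positiveWord A B l₂)⁻¹ := by
  have e1 : thompsonGen A B 1 = B := by simp [thompsonGen]
  have eA : A = thompsonGen A B 0 * (thompsonGen A B 1)⁻¹ := by simp [thompsonGen]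
  have step : ∀ i : ℕ, ∀ y : G, (∃ l₁ l₂, y = positiveWord A B l₁ * (positiveWord A B l₂)⁻¹) →
      ∃ l₁ l₂, (thompsonGen A B i)⁻¹ * y = positiveWord A B l₁ * (positiveWord A B l₂)⁻¹ := by
    rintro i y ⟨l₁, l₂, rfl⟩
    obtain ⟨m₁, m₂, e⟩ := exists_inv_mul_positiveWord hc i l₁
    refine ⟨m₁, l₂ ++ m₂, ?_⟩
    rw [← mul_assoc, e]
    simp [positiveWord, mul_assoc]
  have step' : ∀ i : ℕ, ∀ y : G, (∃ l₁ l₂, y = positiveWord A B l₁ * (positiveWord A B l₂)⁻¹) →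
      ∃ l₁ l₂, thompsonGen A B i * y = positiveWord A B l₁ * (positiveWord A B l₂)⁻¹ := by
    rintro i y ⟨l₁, l₂, rfl⟩
    exact ⟨i :: l₁, l₂, by simp [mul_assoc]⟩
  induction hz using Subgroup.closure_induction_left with
  | one => exact ⟨[], [], by simp⟩
  | mul_left x hx y _ ih =>
    rcases hx with rfl | rfl
    · have := step' 0 _ (step 1 _ ih)
      rwa [← mul_assoc, ← eA] at this
    · have := step' 1 _ ih
      rwa [e1] at this
  | inv_mul_cancel x hx y _ ih =>
    rcases hx with rfl | rfl
    · have := step' 1 _ (step 0 _ ih)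
      rwa [← mul_assoc, show thompsonGen x B 1 * (thompsonGen x B 0)⁻¹ = x⁻¹ by
        simp [thompsonGen]] at this
    · have := step 1 _ ih
      rwa [e1] at this

end Words

/-! ### Fast pairs of order automorphisms generate Thompson's group -/

theorem commute_of_disjoint_supports {X : Type*} [LinearOrder X] {p q : X ≃o X} {c : X}
    (hp : ∀ t, c ≤ t → p t = t) (hq : ∀ t, t ≤ c → q t = t) : Commute p q := by
  refine RelIso.ext fun t => ?_
  simp only [RelIso.mul_apply]
  rcases le_total t c with h | h
  · have : p t ≤ c := by rw [← hp c le_rfl]; exact p.monotone h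
    rw [hq t h, hq _ this]
  · have : c ≤ q t := by
      conv_lhs => rw [← hq c le_rfl]
      exact q.monotone h
    rw [hp t h, hp _ this]

theorem orderIso_inv_apply_self {X : Type*} [LinearOrder X] (e : X ≃o X) (t : X) :
    e (e⁻¹ t) = t := e.apply_symm_apply t

theorem orderIso_inv_apply_apply {X : Type*} [LinearOrder X] (e : X ≃o X) (t : X) :
    e⁻¹ (e t) = t := e.symm_apply_apply t

/-- `A` moves exactly the points below `c` and `B` exactly the points above `b < c`, both to the
left, and `A ∘ B` brings `c` below `b`. -/
structure IsFastPair {X : Type*} [LinearOrder X] (A B : X ≃o X) (b c : X) : Prop where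
  lt : b < c
  left_lt : ∀ t, t < c → A t < t
  left_eq : ∀ t, c ≤ t → A t = t
  right_lt : ∀ t, b < t → B t < t
  right_eq : ∀ t, t ≤ b → B t = t
  fast : A (B c) ≤ b

namespace IsFastPair

variable {X : Type*} [LinearOrder X] {A B : X ≃o X} {b c : X}

theorem left_le (h : IsFastPair A B b c) (t : X) : A t ≤ t :=
  (lt_or_ge t c).elim (fun ht => (h.left_lt t ht).le) fun ht => (h.left_eq t ht).le

theorem right_le (h : IsFastPair A B b c) (t : X) : B t ≤ t :=
  (lt_or_ge b t).elim (fun ht => (h.right_lt t ht).le) fun ht => (h.right_eq t ht).le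

theorem mul_le (h : IsFastPair A B b c) (t : X) : (A * B) t ≤ t := (h.left_le _).trans (h.right_le t)

theorem pow_le (h : IsFastPair A B b c) (n : ℕ) (t : X) : ((A * B) ^ n) t ≤ t := by
  induction n generalizing t with
  | zero => simp
  | succ n ih => rw [pow_succ, RelIso.mul_apply]; exact (ih _).trans (h.mul_le t)

theorem thompsonGen_le (h : IsFastPair A B b c) (n : ℕ) (t : X) : thompsonGen A B n t ≤ t := by
  cases n with
  | zero => exact h.mul_le t
  | succ n =>
    simp only [thompsonGen, RelIso.mul_apply]
    calc ((A * B) ^ n)⁻¹ (B (((A * B) ^ n) t)) ≤ ((A * B) ^ n)⁻¹ (((A * B) ^ n) t) :=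
          (((A * B) ^ n)⁻¹ : X ≃o X).monotone (h.right_le _)
      _ = t := orderIso_inv_apply_apply _ t

theorem positiveWord_le (h : IsFastPair A B b c) (l : List ℕ) (t : X) : positiveWord A B l t ≤ t := by
  induction l with
  | nil => simp
  | cons k l ih =>
    rw [positiveWord_cons, RelIso.mul_apply]
    exact (h.thompsonGen_le _ _).trans ih

/-- For `j ≥ 1` the support of `xⱼ` is the ray above `(AB)^{-(j-1)} b`. These end points increase
with `j`, so `(AB)⁻ᵏ b` is fixed by every `xⱼ` with `j > k` but moved by `xₖ`: it serves as a test
point for the index `k`. -/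
theorem thompsonGen_fix (h : IsFastPair A B b c) {k j : ℕ} (hkj : k < j) :
    thompsonGen A B j (((A * B) ^ k)⁻¹ b) = ((A * B) ^ k)⁻¹ b := by
  obtain ⟨d, rfl⟩ := Nat.exists_eq_add_of_lt hkj
  have e : ((A * B) ^ (k + d)) (((A * B) ^ k)⁻¹ b) ≤ b := by
    rw [add_comm, pow_add, RelIso.mul_apply, orderIso_inv_apply_self]
    exact h.pow_le d b
  simp only [thompsonGen, RelIso.mul_apply]
  rw [h.right_eq _ e, orderIso_inv_apply_apply]

theorem thompsonGen_move (h : IsFastPair A B b c) (k : ℕ) :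
    thompsonGen A B k (((A * B) ^ k)⁻¹ b) < ((A * B) ^ k)⁻¹ b := by
  have hb : (A * B) b < b := by
    rw [RelIso.mul_apply, h.right_eq b le_rfl]
    exact h.left_lt b h.lt
  cases k with
  | zero => simpa [thompsonGen] using hb
  | succ n =>
    have e : b < (A * B)⁻¹ b := by
      rw [← (A * B).lt_iff_lt, orderIso_inv_apply_self]
      exact hb
    have e' : ((A * B) ^ (n + 1))⁻¹ b = ((A * B) ^ n)⁻¹ ((A * B)⁻¹ b) := by
      rw [pow_succ', mul_inv_rev, RelIso.mul_apply]
    rw [e']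
    simp only [thompsonGen, RelIso.mul_apply (_ * _) ((A * B) ^ n),
      RelIso.mul_apply (((A * B) ^ n)⁻¹) B, orderIso_inv_apply_self]
    exact (((A * B) ^ n)⁻¹ : X ≃o X).strictMono (h.right_lt _ e)

theorem positiveWord_fix (h : IsFastPair A B b c) {k : ℕ} {l : List ℕ} (hl : ∀ j ∈ l, k < j) :
    positiveWord A B l (((A * B) ^ k)⁻¹ b) = ((A * B) ^ k)⁻¹ b := by
  induction l with
  | nil => simp
  | cons j l ih =>
    rw [positiveWord_cons, RelIso.mul_apply, ih fun i hi => hl i (List.mem_cons_of_mem _ hi)]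
    exact h.thompsonGen_fix (hl j (by simp))

/-- Fastness is used here: `AB` brings everything up to `c` below `b`, where `B` is trivial, so the
conjugate of `B` lives above `c` and `A` below it. -/
theorem commute_thompsonGen (h : IsFastPair A B b c) (n : ℕ) : Commute A (thompsonGen A B (n + 2)) := by
  refine commute_of_disjoint_supports h.left_eq fun t ht => ?_
  have e : ((A * B) ^ (n + 1)) t ≤ b := by
    rw [pow_succ, RelIso.mul_apply]
    exact (h.pow_le n _).trans (((A * B).monotone ht).trans h.fast)
  simp only [thompsonGen, RelIso.mul_apply]
  rw [h.right_eq _ e, orderIso_inv_apply_apply]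

/-- If a group satisfies the relations of Thompson's group, then two positive words agree in it
as soon as they agree in the image under a homomorphism onto a fast pair. -/
theorem positiveWord_eq_of_map_eq (h : IsFastPair A B b c) {G : Type*} [Group G] {a' b' : G}
    (hc : ∀ {k n : ℕ}, k < n →
      thompsonGen a' b' n * thompsonGen a' b' k = thompsonGen a' b' k * thompsonGen a' b' (n + 1))
    (θ : G →* (X ≃o X)) (ha : θ a' = A) (hb : θ b' = B) (l₁ l₂ : List ℕ)
    (he : θ (positiveWord a' b' l₁) = θ (positiveWord a' b' l₂)) :
    positiveWord a' b' l₁ = positiveWord a' b' l₂ := by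
  -- A word containing its minimal index `k` agrees only with words containing an index `≤ k`.
  have key : ∀ {k : ℕ} {m₁ m₂ : List ℕ}, k ∈ m₁ → (∀ j ∈ m₁, k ≤ j) →
      θ (positiveWord a' b' m₁) = θ (positiveWord a' b' m₂) → ∃ j ∈ m₂, j ≤ k := by
    intro k m₁ m₂ hk hm he
    -- Otherwise the second word fixes the test point `(AB)⁻ᵏ b`, whereas the first, written `xₖ
    -- m'`, moves it strictly down.
    by_contra! hcon
    obtain ⟨m', -, e⟩ := exists_positiveWord_eq_cons hc hk hm
    rw [e, map_mul, map_thompsonGen, map_positiveWord, map_positiveWord, ha, hb] at he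
    have e₂ := h.positiveWord_fix hcon
    rw [← he, RelIso.mul_apply] at e₂
    have := (thompsonGen A B k).monotone (h.positiveWord_le m' (((A * B) ^ k)⁻¹ b))
    rw [e₂] at this
    exact absurd (h.thompsonGen_move k) (not_lt.mpr this)
  have exists_min : ∀ m : List ℕ, m ≠ [] → ∃ k ∈ m, ∀ j ∈ m, k ≤ j := by
    intro m hm
    obtain ⟨k, hk, hk'⟩ := m.toFinset.exists_min_image id
      ⟨m.head hm, by simp⟩
    exact ⟨k, by simpa using hk, fun j hj => hk' j (by simpa using hj)⟩
  induction hn : l₁.length generalizing l₁ l₂ with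
  | zero =>
    obtain rfl := List.length_eq_zero_iff.mp hn
    by_cases hl₂ : l₂ = []
    · rw [hl₂]
    · obtain ⟨k, hk, hk'⟩ := exists_min l₂ hl₂
      obtain ⟨j, hj, -⟩ := key hk hk' he.symm
      simp at hj
  | succ n ih =>
    obtain ⟨k, hk, hk'⟩ := exists_min l₁ (by rintro rfl; simp at hn)
    obtain ⟨j, hj, hjk⟩ := key hk hk' he
    obtain ⟨i, hi, hi'⟩ := exists_min l₂ (by rintro rfl; simp at hj)
    obtain ⟨j', hj', hji⟩ := key hi hi' he.symm
    have hik : i = k := le_antisymm ((hi' j hj).trans hjk) ((hk' j' hj').trans hji)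
    subst hik
    obtain ⟨m₁, hm₁, e₁⟩ := exists_positiveWord_eq_cons hc hk hk'
    obtain ⟨m₂, -, e₂⟩ := exists_positiveWord_eq_cons hc hi hi'
    -- Both words have the same least index, so that letter cancels from both.
    rw [e₁, e₂, map_mul, map_mul] at he
    rw [e₁, e₂, ih m₁ m₂ (mul_left_cancel he) (by omega)]

end IsFastPair

theorem thompsonRelator_lift {G : Type*} [Group G] (a b : G) (k : ℕ) :
    FreeGroup.lift ![a, b] (thompsonRelator k) = 1 ↔ Commute a (thompsonGen a b (k + 1)) := by
  simp only [thompsonRelator, thompsonGen, map_mul, map_inv, map_pow, FreeGroup.lift_apply_of,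
    Matrix.cons_val_zero, Matrix.cons_val_one]
  rw [mul_inv_eq_one, mul_inv_eq_iff_eq_mul]
  rfl

theorem IsFastPair.lift_relator {X : Type*} [LinearOrder X] {A B : X ≃o X} {b c : X}
    (h : IsFastPair A B b c) :
    ∀ r ∈ ({thompsonRelator 1, thompsonRelator 2} : Set (FreeGroup (Fin 2))),
      FreeGroup.lift ![A, B] r = 1 := by
  rintro r (rfl | rfl)
  · exact (thompsonRelator_lift A B 1).mpr (h.commute_thompsonGen 0)
  · exact (thompsonRelator_lift A B 2).mpr (h.commute_thompsonGen 1)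

theorem thompsonF_commute {k : ℕ} (hk : k = 1 ∨ k = 2) :
    Commute (PresentedGroup.of 0 : ThompsonF)
      (thompsonGen (PresentedGroup.of 0 : ThompsonF) (PresentedGroup.of 1) (k + 1)) := by
  rw [← thompsonRelator_lift]
  have e : FreeGroup.lift ![(PresentedGroup.of 0 : ThompsonF), PresentedGroup.of 1]
      = PresentedGroup.mk {thompsonRelator 1, thompsonRelator 2} := by
    ext i
    fin_cases i <;> simp [PresentedGroup.of]
  rw [e]
  apply PresentedGroup.one_of_mem
  rcases hk with rfl | rfl <;> simp

/-- The natural map from Thompson's group onto the group generated by a fast pair is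
injective. -/
theorem IsFastPair.toGroup_injective {X : Type*} [LinearOrder X] {A B : X ≃o X} {b c : X}
    (h : IsFastPair A B b c) :
    Function.Injective (PresentedGroup.toGroup h.lift_relator : ThompsonF →* (X ≃o X)) := by
  rw [injective_iff_map_eq_one]
  intro z hz
  have hc : ∀ {k n : ℕ}, k < n → _ := fun {k n} hkn =>
    thompsonGen_mul_comm (thompsonF_commute (.inl rfl)) (thompsonF_commute (.inr rfl)) hkn
  have hmem : z ∈ Subgroup.closure {(PresentedGroup.of 0 : ThompsonF), PresentedGroup.of 1} := by
    have := PresentedGroup.closure_range_of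
      ({thompsonRelator 1, thompsonRelator 2} : Set (FreeGroup (Fin 2)))
    rw [show Set.range (PresentedGroup.of : Fin 2 → ThompsonF)
      = {PresentedGroup.of 0, PresentedGroup.of 1} by
        ext; simp [Fin.exists_fin_two, eq_comm]] at this
    rw [this]
    trivial
  obtain ⟨l₁, l₂, rfl⟩ := exists_positiveWord_mul_inv hc hmem
  rw [map_mul, map_inv, mul_inv_eq_one] at hz
  rw [mul_inv_eq_one]
  exact h.positiveWord_eq_of_map_eq hc _ (by simp [PresentedGroup.toGroup.of])
    (by simp [PresentedGroup.toGroup.of]) l₁ l₂ hz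

theorem range_toGroup_eq_closure {G : Type*} [Group G] {a b : G}
    {rels : Set (FreeGroup (Fin 2))} (hr : ∀ r ∈ rels, FreeGroup.lift ![a, b] r = 1) :
    (PresentedGroup.toGroup hr).range = Subgroup.closure {a, b} := by
  rw [MonoidHom.range_eq_map, ← PresentedGroup.closure_range_of, MonoidHom.map_closure,
    ← Set.range_comp]
  congr 1
  ext
  simp [Fin.exists_fin_two, eq_comm]

/-! ### Extending order automorphisms of the line to the unit interval -/

noncomputable section

/-- An order isomorphism of the real line with the open unit interval. -/
def realIsoIoo : ℝ ≃o Set.Ioo (0 : ℝ) 1 :=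
  (orderIsoIooNegOneOne ℝ).trans
    { toFun := fun x => ⟨(x.1 + 1) / 2, by have := x.2.1; have := x.2.2; constructor <;> linarith⟩
      invFun := fun x => ⟨2 * x.1 - 1, by have := x.2.1; have := x.2.2; constructor <;> linarith⟩
      left_inv := fun x => by ext; simp; ring
      right_inv := fun x => by ext; simp
      map_rel_iff' := by
        intro x y
        change (x.1 + 1) / 2 ≤ (y.1 + 1) / 2 ↔ x.1 ≤ y.1
        constructor <;> intro h <;> linarith }

/-- The embedding of the real line as the interior of the unit interval. -/
def realToUnit (t : ℝ) : UnitI := ⟨realIsoIoo t, (realIsoIoo t).2.1.le, (realIsoIoo t).2.2.le⟩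

theorem realToUnit_strictMono : StrictMono realToUnit := fun _ _ h =>
  realIsoIoo.strictMono h

theorem zero_lt_realToUnit (t : ℝ) : (0 : UnitI) < realToUnit t := (realIsoIoo t).2.1

theorem realToUnit_lt_one (t : ℝ) : realToUnit t < (1 : UnitI) := (realIsoIoo t).2.2

theorem unit_cases (x : UnitI) : x = 0 ∨ x = 1 ∨ ∃ t, x = realToUnit t := by
  rcases x.2.1.eq_or_lt with h | h
  · exact .inl (Subtype.ext h.symm)
  rcases x.2.2.eq_or_lt with h' | h'
  · exact .inr (.inl (Subtype.ext h'))
  · refine .inr (.inr ⟨realIsoIoo.symm ⟨x, h, h'⟩, ?_⟩)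
    ext
    simp [realToUnit]

open Classical in
/-- The extension of a self-map of the line to the unit interval fixing the end points. -/
def extendFun (σ : ℝ → ℝ) (x : UnitI) : UnitI :=
  if h : ∃ t, x = realToUnit t then realToUnit (σ h.choose) else x

theorem extendFun_realToUnit (σ : ℝ → ℝ) (t : ℝ) :
    extendFun σ (realToUnit t) = realToUnit (σ t) := by
  have h : ∃ s, realToUnit t = realToUnit s := ⟨t, rfl⟩
  rw [extendFun, dif_pos h, ← realToUnit_strictMono.injective h.choose_spec]

theorem extendFun_zero (σ : ℝ → ℝ) : extendFun σ 0 = 0 :=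
  dif_neg fun ⟨t, h⟩ => (zero_lt_realToUnit t).ne h

theorem extendFun_one (σ : ℝ → ℝ) : extendFun σ 1 = 1 :=
  dif_neg fun ⟨t, h⟩ => (realToUnit_lt_one t).ne' h

theorem extendFun_comp (σ τ : ℝ → ℝ) (x : UnitI) :
    extendFun σ (extendFun τ x) = extendFun (σ ∘ τ) x := by
  rcases unit_cases x with rfl | rfl | ⟨t, rfl⟩ <;>
    simp [extendFun_zero, extendFun_one, extendFun_realToUnit]

theorem extendFun_id (x : UnitI) : extendFun id x = x := by
  rcases unit_cases x with rfl | rfl | ⟨t, rfl⟩ <;>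
    simp [extendFun_zero, extendFun_one, extendFun_realToUnit]

theorem extendFun_strictMono {σ : ℝ → ℝ} (hσ : StrictMono σ) : StrictMono (extendFun σ) := by
  intro x y h
  rcases unit_cases x with rfl | rfl | ⟨t, rfl⟩ <;>
    rcases unit_cases y with rfl | rfl | ⟨s, rfl⟩
  · exact absurd h (lt_irrefl _)
  · simp [extendFun_zero, extendFun_one]
  · simpa [extendFun_zero, extendFun_realToUnit] using zero_lt_realToUnit _
  · exact absurd h (not_lt.mpr zero_le_one)
  · exact absurd h (lt_irrefl _)
  · exact absurd h (not_lt.mpr (realToUnit_lt_one s).le)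
  · exact absurd h (not_lt.mpr (zero_lt_realToUnit t).le)
  · simpa [extendFun_one, extendFun_realToUnit] using realToUnit_lt_one _
  · rw [extendFun_realToUnit, extendFun_realToUnit]
    exact realToUnit_strictMono (hσ (realToUnit_strictMono.lt_iff_lt.mp h))

/-- The extension of an order automorphism of the line to the unit interval. -/
def extendIso (σ : ℝ ≃o ℝ) : UnitI ≃o UnitI :=
  (extendFun_strictMono σ.strictMono).orderIsoOfRightInverse _ (extendFun σ.symm) fun x => by
    rw [extendFun_comp, show σ ∘ σ.symm = id from funext σ.apply_symm_apply, extendFun_id]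

/-- Order automorphisms of the line act on the unit interval. -/
def extendHom : (ℝ ≃o ℝ) →* HomeoPlus where
  -- Continuity is automatic for an order isomorphism in the order topology.
  toFun σ := ⟨(extendIso σ).toHomeomorph, extendFun_strictMono σ.strictMono⟩
  map_one' := Subtype.ext (Homeomorph.ext extendFun_id)
  map_mul' σ τ := Subtype.ext (Homeomorph.ext fun x => (extendFun_comp σ τ x).symm)

theorem extendHom_apply (σ : ℝ ≃o ℝ) (x : UnitI) :
    (extendHom σ : UnitI ≃ₜ UnitI) x = extendFun σ x := rfl

theorem extendHom_injective : Function.Injective extendHom := by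
  intro σ τ h
  refine RelIso.ext fun t => realToUnit_strictMono.injective ?_
  rw [← extendFun_realToUnit, ← extendFun_realToUnit, ← extendHom_apply, ← extendHom_apply, h]

theorem openSupport_extendHom (σ : ℝ ≃o ℝ) :
    openSupport (extendHom σ) = realToUnit '' {t | σ t ≠ t} := by
  ext x
  simp only [openSupport, Set.mem_ofPred_eq, extendHom_apply, Set.mem_image]
  rcases unit_cases x with rfl | rfl | ⟨t, rfl⟩
  · simp [extendFun_zero, (zero_lt_realToUnit _).ne']
  · simp [extendFun_one, (realToUnit_lt_one _).ne]
  · simp [extendFun_realToUnit, realToUnit_strictMono.injective.eq_iff]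

theorem image_realToUnit_Iio (c : ℝ) :
    realToUnit '' Set.Iio c = Set.Ioo 0 (realToUnit c) := by
  ext x
  rcases unit_cases x with rfl | rfl | ⟨t, rfl⟩
  · simp [(zero_lt_realToUnit _).ne']
  · simp [(realToUnit_lt_one _).ne, (realToUnit_lt_one _).le]
  · simp [realToUnit_strictMono.injective.eq_iff, realToUnit_strictMono.lt_iff_lt,
      zero_lt_realToUnit]

theorem image_realToUnit_Ioi (b : ℝ) :
    realToUnit '' Set.Ioi b = Set.Ioo (realToUnit b) 1 := by
  ext x
  rcases unit_cases x with rfl | rfl | ⟨t, rfl⟩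
  · simp [(zero_lt_realToUnit _).ne']
  · simp [(realToUnit_lt_one _).ne]
  · simp [realToUnit_strictMono.injective.eq_iff, realToUnit_strictMono.lt_iff_lt,
      realToUnit_lt_one]

theorem isTwoChain_extendHom {σ τ : ℝ ≃o ℝ} {b c : ℝ} (hbc : b < c)
    (hσ : {t | σ t ≠ t} = Set.Iio c) (hτ : {t | τ t ≠ t} = Set.Ioi b) :
    IsTwoChain (openSupport (extendHom σ)) (openSupport (extendHom τ)) := by
  rw [openSupport_extendHom, openSupport_extendHom, hσ, hτ]
  refine ⟨⟨_, _, zero_lt_realToUnit c, image_realToUnit_Iio c⟩,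
    ⟨_, _, realToUnit_lt_one b, image_realToUnit_Ioi b⟩, ?_, ?_⟩
  · obtain ⟨m, h₁, h₂⟩ := exists_between hbc
    exact ⟨realToUnit m, ⟨m, h₂, rfl⟩, ⟨m, h₁, rfl⟩⟩
  · rw [← Set.image_inter realToUnit_strictMono.injective]
    refine ⟨⟨Set.image_mono Set.inter_subset_left, fun hs => ?_⟩,
      ⟨Set.image_mono Set.inter_subset_right, fun hs => ?_⟩⟩ <;>
      rw [Set.image_subset_image_iff realToUnit_strictMono.injective] at hs
    · exact lt_irrefl b (hs (show b ∈ Set.Iio c from hbc)).2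
    · exact lt_irrefl c (hs (show c ∈ Set.Ioi b from hbc)).1

/-- Order automorphisms of the line with overlapping supports and fast squares yield a square
root of Thompson's group. -/
theorem isSquareRootOfF_extendHom {f g : ℝ ≃o ℝ} {b c : ℝ} (h : IsFastPair (f ^ 2) (g ^ 2) b c)
    (hf : {t | f t ≠ t} = Set.Iio c) (hg : {t | g t ≠ t} = Set.Ioi b) :
    IsSquareRootOfF (Subgroup.closure {extendHom f, extendHom g}) := by
  refine ⟨_, _, rfl, isTwoChain_extendHom h.lt hf hg, ?_⟩
  have e : (extendHom.comp (PresentedGroup.toGroup h.lift_relator)).range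
      = Subgroup.closure {extendHom f ^ 2, extendHom g ^ 2} := by
    rw [MonoidHom.range_comp, range_toGroup_eq_closure, MonoidHom.map_closure]
    simp [Set.image_pair]
  have hinj : Function.Injective
      (extendHom.comp (PresentedGroup.toGroup h.lift_relator : ThompsonF →* _)) :=
    extendHom_injective.comp h.toGroup_injective
  exact ⟨(MulEquiv.subgroupCongr e.symm).trans (MonoidHom.ofInjective hinj).symm⟩

end

/-! ### A one-parameter family of square roots -/

noncomputable section

/-- The pointwise maximum of two order automorphisms. -/
def maxIso {X : Type*} [LinearOrder X] (e₁ e₂ : X ≃o X) : X ≃o X :=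
  StrictMono.orderIsoOfRightInverse (fun x => max (e₁ x) (e₂ x))
    (fun _ _ h => max_lt_max (e₁.strictMono h) (e₂.strictMono h))
    (fun y => min (e₁.symm y) (e₂.symm y)) fun y => by
      rcases le_total (e₁.symm y) (e₂.symm y) with h | h
      · have : e₂ (e₁.symm y) ≤ y := by simpa using e₂.monotone h
        simp [min_eq_left h, this]
      · have : e₁ (e₂.symm y) ≤ y := by simpa using e₁.monotone h
        simp [min_eq_right h, this]

/-- The affine order automorphism `x ↦ m x + k` of the line, for `m > 0`. -/
def affineIso (m k : ℝ) (hm : 0 < m) : ℝ ≃o ℝ :=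
  StrictMono.orderIsoOfRightInverse (fun x => m * x + k)
    (fun _ _ h => by
      have := mul_lt_mul_of_pos_left h hm
      simpa using this)
    (fun y => (y - k) / m) fun y => by field_simp; ring

/-- The piecewise linear map `x ↦ min x (2x)`, which moves the points `x < 0` to the left. -/
def leftRoot : ℝ ≃o ℝ := (maxIso 1 (affineIso (1 / 2) 0 (by norm_num)))⁻¹

/-- The inverse of the piecewise linear map with slopes `1`, `3/2`, `s` and break points `-1`,
`-1/2`, which moves the points `x > -1` to the left. -/
def rightRoot (s : Set.Icc (3 / 2 : ℝ) 2) : ℝ ≃o ℝ :=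
  (maxIso 1 (maxIso (affineIso (3 / 2) (1 / 2) (by norm_num))
    -- The constant makes the last two lines meet at `(-1/2, -1/4)`. As `s ≥ 3/2`, the slopes do not
    -- decrease, so the maximum follows the three lines in turn.
    (affineIso s (s / 2 - 1 / 4) (by linarith [s.2.1]))))⁻¹

theorem leftRoot_inv_apply (t : ℝ) : leftRoot⁻¹ t = max t (t / 2) := by
  change max t ((1 / 2) * t + 0) = _
  congr 1; ring

theorem rightRoot_inv_apply (s : Set.Icc (3 / 2 : ℝ) 2) (t : ℝ) :
    (rightRoot s)⁻¹ t = max t (max (3 / 2 * t + 1 / 2) (s * t + (s / 2 - 1 / 4))) := rfl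

theorem leftRoot_of_nonneg {t : ℝ} (ht : 0 ≤ t) : leftRoot t = t := by
  have : leftRoot⁻¹ t = t := by rw [leftRoot_inv_apply, max_eq_left (by linarith)]
  conv_lhs => rw [← this]
  exact orderIso_inv_apply_self _ _

theorem leftRoot_of_nonpos {t : ℝ} (ht : t ≤ 0) : leftRoot t = 2 * t := by
  have : leftRoot⁻¹ (2 * t) = t := by
    rw [leftRoot_inv_apply, max_eq_right (by linarith)]; ring
  conv_lhs => rw [← this]
  exact orderIso_inv_apply_self _ _

theorem leftRoot_inv_of_nonpos {t : ℝ} (ht : t ≤ 0) : leftRoot⁻¹ t = t / 2 := by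
  rw [leftRoot_inv_apply, max_eq_right (by linarith)]

theorem leftRoot_le (t : ℝ) : leftRoot t ≤ t := by
  rcases le_total 0 t with h | h
  · rw [leftRoot_of_nonneg h]
  · rw [leftRoot_of_nonpos h]; linarith

theorem leftRoot_lt {t : ℝ} (ht : t < 0) : leftRoot t < t := by
  rw [leftRoot_of_nonpos ht.le]; linarith

section RightRoot

variable (s : Set.Icc (3 / 2 : ℝ) 2)

theorem rightRoot_of_le {t : ℝ} (ht : t ≤ -1) : rightRoot s t = t := by
  have : (rightRoot s)⁻¹ t = t := by
    rw [rightRoot_inv_apply, max_eq_left]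
    refine max_le (by linarith) ?_
    nlinarith [s.2.1]
  conv_lhs => rw [← this]
  exact orderIso_inv_apply_self _ _

theorem rightRoot_lt {t : ℝ} (ht : -1 < t) : rightRoot s t < t := by
  have : t < (rightRoot s)⁻¹ t := by
    rw [rightRoot_inv_apply]
    exact lt_max_of_lt_right (lt_max_of_lt_left (by linarith))
  simpa [orderIso_inv_apply_self] using (rightRoot s).strictMono this

theorem rightRoot_le (t : ℝ) : rightRoot s t ≤ t :=
  (lt_or_ge (-1) t).elim (fun h => (rightRoot_lt s h).le) fun h => (rightRoot_of_le s h).le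

theorem rightRoot_near {r : ℝ} (h₀ : 0 ≤ r) (h₁ : r ≤ 3 / 4) :
    rightRoot s (-1 + r) = -1 + 2 / 3 * r := by
  have : (rightRoot s)⁻¹ (-1 + 2 / 3 * r) = -1 + r := by
    rw [rightRoot_inv_apply, max_eq_left (a := 3 / 2 * _ + _), max_eq_right]
    · ring
    · linarith
    · nlinarith [s.2.1]
  conv_lhs => rw [← this]
  exact orderIso_inv_apply_self _ _

/-- The parameter `s` enters the map only on this ray; below `-1/4` all the maps agree. -/
theorem rightRoot_far {r : ℝ} (h₀ : 0 ≤ r) :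
    rightRoot s (-1 / 4 + r) = -1 / 2 + r / s := by
  have hs := s.2.1
  have hs0 : (0 : ℝ) < s := by linarith
  have : (rightRoot s)⁻¹ (-1 / 2 + r / s) = -1 / 4 + r := by
    have e : (s : ℝ) * (r / s) = r := by field_simp
    have hrs : 0 ≤ r / s := by positivity
    rw [rightRoot_inv_apply]
    generalize r / (s : ℝ) = q at *
    rw [max_eq_right (a := 3 / 2 * _ + _), max_eq_right]
    · linear_combination e
    · nlinarith
    · nlinarith
  conv_lhs => rw [← this]
  exact orderIso_inv_apply_self _ _

theorem isFastPair_roots : IsFastPair (leftRoot ^ 2) (rightRoot s ^ 2) (-1) 0 where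
  lt := by norm_num
  left_lt t ht := by
    rw [pow_two, RelIso.mul_apply]
    exact (leftRoot_le _).trans_lt (leftRoot_lt ht)
  left_eq t ht := by
    rw [pow_two, RelIso.mul_apply, leftRoot_of_nonneg ht, leftRoot_of_nonneg ht]
  right_lt t ht := by
    rw [pow_two, RelIso.mul_apply]
    exact (rightRoot_le s _).trans_lt (rightRoot_lt s ht)
  right_eq t ht := by
    rw [pow_two, RelIso.mul_apply, rightRoot_of_le s ht, rightRoot_of_le s ht]
  fast := by
    -- The orbit of `0` is bounded step by step: `rightRoot s` takes it to at most `-1/4`, then to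
    -- at most `-1/2`, and `leftRoot` takes `-1/2` to `-1`.
    have hs := s.2.1
    have h₀ : rightRoot s 0 ≤ -1 / 4 + 0 := by
      have h := rightRoot_far s (r := 1 / 4) (by norm_num)
      have h' : (1 / 4 : ℝ) / s ≤ 1 / 4 := div_le_self (by norm_num) (by linarith)
      rw [show (-1 / 4 + 1 / 4 : ℝ) = 0 by norm_num] at h
      linarith
    have h₁ := (rightRoot s).monotone h₀
    rw [rightRoot_far s le_rfl, zero_div, add_zero] at h₁
    have h₂ : leftRoot (-1 / 2) = -1 := by rw [leftRoot_of_nonpos (by norm_num)]; norm_num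
    rw [pow_two, pow_two, RelIso.mul_apply, RelIso.mul_apply]
    exact (leftRoot_le _).trans ((leftRoot.monotone h₁).trans h₂.le)

theorem support_leftRoot : {t | leftRoot t ≠ t} = Set.Iio 0 := by
  ext t
  rcases lt_or_ge t 0 with h | h
  · simpa [h] using (leftRoot_lt h).ne
  · simp [leftRoot_of_nonneg h, h]

theorem support_rightRoot : {t | rightRoot s t ≠ t} = Set.Ioi (-1) := by
  ext t
  rcases lt_or_ge (-1) t with h | h
  · simpa [h] using (rightRoot_lt s h).ne
  · simp [rightRoot_of_le s h, h]

end RightRoot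

/-! ### The parameter is determined by the marked group -/

section Encode

variable {G H : Type*} [Group G] [Group H]

/-- The element `p q p⁻²`; for the roots above it is a contraction near the point `-1`. -/
def contraction (p q : G) : G := p * q * (p⁻¹ * p⁻¹)

/-- A family of relations, indexed by pairs of natural numbers, between two group elements. -/
def EncodingRelation (p q : G) (i j : ℕ) : Prop :=
  Commute (contraction p q ^ j * p * (contraction p q ^ j)⁻¹) (q ^ i * p⁻¹ * q * (q ^ i * p⁻¹)⁻¹)

/-- The relation is an equation between words in `p` and `q`, so it depends only on the marked group
they generate. -/
theorem encodingRelation_map {θ : G →* H} (hθ : Function.Injective θ) (p q : G) (i j : ℕ) :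
    EncodingRelation (θ p) (θ q) i j ↔ EncodingRelation p q i j := by
  simp only [EncodingRelation, contraction, Commute, SemiconjBy, ← map_mul, ← map_inv, ← map_pow,
    hθ.eq_iff]

end Encode

theorem commute_iff_of_supports {X : Type*} [LinearOrder X] {p q : X ≃o X} {b c : X}
    (hp : ∀ t, c ≤ t → p t = t) (hp' : ∀ t, t < c → p t < t)
    (hq : ∀ t, t ≤ b → q t = t) (hq' : ∀ t, b < t → q t ≠ t) : Commute p q ↔ c ≤ b := by
  refine ⟨fun h => ?_, fun h =>
    commute_of_disjoint_supports hp fun t ht => hq t (ht.trans h)⟩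
  by_contra! hbc
  -- An element commuting with `q` preserves its fixed points, but `p⁻¹` would push the fixed point
  -- `b` into the support of `q`.
  have h₁ : b < p⁻¹ b := by
    rw [← p.lt_iff_lt, orderIso_inv_apply_self]
    exact hp' b hbc
  refine hq' _ h₁ ?_
  have := DFunLike.congr_fun h.inv_left.eq b
  rw [RelIso.mul_apply, RelIso.mul_apply, hq b le_rfl] at this
  exact this.symm

theorem conj_commute_iff {X : Type*} [LinearOrder X] {p q : X ≃o X} {b c : X}
    (hp : ∀ t, c ≤ t → p t = t) (hp' : ∀ t, t < c → p t < t)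
    (hq : ∀ t, t ≤ b → q t = t) (hq' : ∀ t, b < t → q t ≠ t) (w v : X ≃o X) :
    Commute (w * p * w⁻¹) (v * q * v⁻¹) ↔ w c ≤ v b := by
  apply commute_iff_of_supports
  · intro t ht
    have : c ≤ w⁻¹ t := by rwa [← w.le_iff_le, orderIso_inv_apply_self]
    rw [RelIso.mul_apply, RelIso.mul_apply, hp _ this, orderIso_inv_apply_self]
  · intro t ht
    have : w⁻¹ t < c := by rwa [← w.lt_iff_lt, orderIso_inv_apply_self]
    simpa [orderIso_inv_apply_self] using w.strictMono (hp' _ this)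
  · intro t ht
    have : v⁻¹ t ≤ b := by rwa [← v.le_iff_le, orderIso_inv_apply_self]
    rw [RelIso.mul_apply, RelIso.mul_apply, hq _ this, orderIso_inv_apply_self]
  · intro t ht h
    have : b < v⁻¹ t := by rwa [← v.lt_iff_lt, orderIso_inv_apply_self]
    apply hq' _ this
    rw [← v.injective.eq_iff, orderIso_inv_apply_self]
    exact h

/-- `leftRoot⁻¹` applied twice carries `[-1, 0]` to `[-1/4, 0]`, where `rightRoot s` has slope
`1/s`; `leftRoot` then doubles. The total slope is `1/4 · 1/s · 2`. -/
theorem contraction_apply (s : Set.Icc (3 / 2 : ℝ) 2) {r : ℝ} (h₀ : 0 ≤ r) (h₁ : r ≤ 1) :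
    contraction leftRoot (rightRoot s) (-1 + r) = -1 + r / (2 * s) := by
  have hs := s.2.1
  have hs0 : (0 : ℝ) < s := by linarith
  have e : r / (2 * s) ≤ 1 := by
    rw [div_le_one (by linarith)]
    linarith
  simp only [contraction, RelIso.mul_apply]
  rw [leftRoot_inv_of_nonpos (t := -1 + r) (by linarith), leftRoot_inv_of_nonpos (by linarith),
    show (-1 + r) / 2 / 2 = -1 / 4 + r / 4 by ring, rightRoot_far s (by linarith),
    show -1 / 2 + r / 4 / s = (-1 + r / (2 * s)) / 2 by field_simp; ring,
    leftRoot_of_nonpos (by linarith)]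
  ring

theorem contraction_pow_apply (s : Set.Icc (3 / 2 : ℝ) 2) (j : ℕ) :
    (contraction leftRoot (rightRoot s) ^ j) 0 = -1 + ((2 * s : ℝ) ^ j)⁻¹ := by
  have hs := s.2.1
  induction j with
  | zero => simp
  | succ j ih =>
    have h₁ : ((2 * s : ℝ) ^ j)⁻¹ ≤ 1 := inv_le_one_of_one_le₀ (one_le_pow₀ (by linarith))
    have h₀ : 0 ≤ ((2 * s : ℝ) ^ j)⁻¹ := by
      have : (0 : ℝ) < s := by linarith
      positivity
    rw [pow_succ', RelIso.mul_apply, ih, contraction_apply s h₀ h₁, pow_succ, mul_inv]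
    rfl

theorem rightRoot_pow_apply (s : Set.Icc (3 / 2 : ℝ) 2) (i : ℕ) :
    (rightRoot s ^ i) (leftRoot⁻¹ (-1)) = -1 + (2 * (3 / 2 : ℝ) ^ i)⁻¹ := by
  induction i with
  | zero =>
    rw [leftRoot_inv_of_nonpos (by norm_num)]
    norm_num
  | succ i ih =>
    have h₁ : (2 * (3 / 2 : ℝ) ^ i)⁻¹ ≤ 3 / 4 := by
      have : (1 : ℝ) ≤ (3 / 2 : ℝ) ^ i := one_le_pow₀ (by norm_num)
      rw [inv_le_comm₀ (by positivity) (by norm_num)]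
      linarith
    rw [pow_succ', RelIso.mul_apply, ih, rightRoot_near s (by positivity) h₁, pow_succ]
    field_simp

theorem encodingRelation_roots (s : Set.Icc (3 / 2 : ℝ) 2) (i j : ℕ) :
    EncodingRelation leftRoot (rightRoot s) i j ↔ 2 * (3 / 2 : ℝ) ^ i ≤ (2 * s : ℝ) ^ j := by
  have hs := s.2.1
  have hs0 : (0 : ℝ) < s := by linarith
  rw [EncodingRelation, conj_commute_iff (fun _ => leftRoot_of_nonneg) (fun _ => leftRoot_lt)
    (fun _ => rightRoot_of_le s) (fun _ h => (rightRoot_lt s h).ne), contraction_pow_apply,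
    RelIso.mul_apply, rightRoot_pow_apply, add_le_add_iff_left,
    inv_le_inv₀ (by positivity) (by positivity)]

theorem le_of_encodingRelation_imp {s s' : Set.Icc (3 / 2 : ℝ) 2}
    (h : ∀ i j, EncodingRelation leftRoot (rightRoot s') i j →
      EncodingRelation leftRoot (rightRoot s) i j) : s' ≤ s := by
  by_contra! hlt
  have hs := s.2.1
  have hs0 : (0 : ℝ) < s := by linarith
  have hlt' : (s : ℝ) < s' := hlt
  -- Once the ratio of `(2s')^j` to `(2s)^j` exceeds `3/2`, some term of the progression `2 (3/2)^i`
  -- falls between them.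
  obtain ⟨j, hj⟩ := pow_unbounded_of_one_lt (3 / 2 : ℝ) ((one_lt_div hs0).mpr hlt')
  have hj' : 3 / 2 * (2 * s : ℝ) ^ j < (2 * s' : ℝ) ^ j := by
    rw [div_pow, lt_div_iff₀ (by positivity)] at hj
    rw [mul_pow, mul_pow]
    nlinarith [pow_pos (two_pos : (0 : ℝ) < 2) j]
  have hj0 : j ≠ 0 := by
    rintro rfl
    norm_num at hj
  have hone : 2 ≤ (2 * s : ℝ) ^ j :=
    le_trans (by linarith) (le_self_pow₀ (by linarith) hj0)
  obtain ⟨i, hi₁, hi₂⟩ := exists_nat_pow_near (x := (2 * s : ℝ) ^ j / 2) (y := (3 / 2 : ℝ))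
    (by linarith) (by norm_num)
  have h₁ := (encodingRelation_roots s' (i + 1) j).mpr (by
    rw [pow_succ]; linarith)
  have h₂ := (encodingRelation_roots s (i + 1) j).mp (h _ _ h₁)
  linarith

/-! ### Uncountably many isomorphism classes -/

/-- The square root of Thompson's group with parameter `s`. -/
def squareRoot (s : Set.Icc (3 / 2 : ℝ) 2) : {G : Subgroup HomeoPlus // IsSquareRootOfF G} :=
  ⟨Subgroup.closure {extendHom leftRoot, extendHom (rightRoot s)},
    isSquareRootOfF_extendHom (isFastPair_roots s) support_leftRoot (support_rightRoot s)⟩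

theorem countable_of_isSquareRootOfF {G : Subgroup HomeoPlus} (h : IsSquareRootOfF G) :
    Countable G := by
  obtain ⟨f, g, rfl, -⟩ := h
  have : (FreeGroup.lift ![f, g]).range = Subgroup.closure {f, g} := by
    rw [FreeGroup.range_lift_eq_closure]
    simp [Set.pair_comm]
  rw [← this]
  exact (FreeGroup.lift ![f, g]).rangeRestrict_surjective.countable

/-- A pair in an arbitrary group isomorphic to a square root, marked by the standard
generators. -/
theorem exists_marking (s : Set.Icc (3 / 2 : ℝ) 2) {G : Type*} [Group G]
    (e : (squareRoot s).1 ≃* G) :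
    ∃ p : G × G, ∀ i j, EncodingRelation p.1 p.2 i j ↔
      EncodingRelation leftRoot (rightRoot s) i j := by
  let f : (squareRoot s).1 := ⟨extendHom leftRoot, Subgroup.subset_closure (by simp)⟩
  let g : (squareRoot s).1 := ⟨extendHom (rightRoot s), Subgroup.subset_closure (by simp)⟩
  refine ⟨(e f, e g), fun i j => ?_⟩
  -- Both sides are compared with the relation inside the subgroup, which embeds in `HomeoPlus` and
  -- is carried to `G` by `e`.
  rw [← encodingRelation_map extendHom_injective]
  exact (encodingRelation_map (θ := e.toMonoidHom) e.injective f g i j).trans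
    (encodingRelation_map (Subgroup.subtype_injective _) f g i j).symm

end

theorem theorem1p9 : Uncountable SquareRootClasses := by
  rw [← not_countable_iff]
  intro hcount
  let cls : Set.Icc (3 / 2 : ℝ) 2 → SquareRootClasses := fun s => Quotient.mk squareRootIso
    (squareRoot s)
  have hiso : ∀ s, Nonempty ((squareRoot s).1 ≃* (Quotient.out (cls s)).1) := fun s =>
    squareRootIso.symm (Quotient.mk_out (squareRoot s))
  choose p hp using fun s => exists_marking s (hiso s).some
  have hc : ∀ c : SquareRootClasses, Countable (Quotient.out c).1 := fun c =>
    countable_of_isSquareRootOfF (Quotient.out c).2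
  -- The generators are transported to a representative chosen per class, so that markings within
  -- one class lie in the same group.
  let mark : Set.Icc (3 / 2 : ℝ) 2 →
      Σ c : SquareRootClasses, (Quotient.out c).1 × (Quotient.out c).1 := fun s => ⟨cls s, p s⟩
  have hrel : ∀ s i j, EncodingRelation (mark s).2.1 (mark s).2.2 i j ↔
      EncodingRelation leftRoot (rightRoot s) i j := hp
  have hinj : Function.Injective mark := by
    intro s s' h
    apply le_antisymm
    · refine le_of_encodingRelation_imp fun i j hr => ?_
      rwa [← hrel, ← h, hrel]
    · refine le_of_encodingRelation_imp fun i j hr => ?_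
      rwa [← hrel, h, hrel]
  -- The target is a countable union of squares of countable groups.
  have : Countable (Set.Icc (3 / 2 : ℝ) 2) := hinj.countable
  exact absurd (Set.countable_coe_iff.mp this)
    (Cardinal.Real.Icc_countable_iff.not.mpr (by norm_num))
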